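/- Let $G$ be a finite simple graph and let $M$ be a perfect matching of $G$, viewed as a set of edges. A set $S\subseteq E(G)\setminus M$ is an anti-forcing set of $M$ if $M$ is the only perfect matching of $G-S$ (the graph obtained from $G$ by deleting the edges in $S$). The anti-forcing number $af(G,M)$ is the minimum size of an anti-forcing set of $M$. The anti-forcing polynomial of $G$ is $Af(G,x)=\sum_{M} x^{af(G,M)}$, where $M$ ranges over all perfect matchings of $G$. For $n\ge 1$ let $G_n$ be the polyomino graph with vertices $u_i,v_i$ $(0\le i\le 2n)$ and $w_i,z_i$ $(1\le i\le 2n)$ that is made up of the following $4n$ squares: the $2n$ squares $u_iu_{i+1}v_{i+1}v_i$ $(0\le i\le 2n-1)$ and, for $1\le k\le n$, the $2n$ squares $w_{2k-1}w_{2k}u_{2k}u_{2k-1}$ and $v_{2k-1}v_{2k}z_{2k}z_{2k-1}$. That is, its edges are $u_iv_i$ $(0\le i\le 2n)$, $u_iu_{i+1}$ and $v_iv_{i+1}$ $(0\le i\le 2n-1)$, $w_iu_i$ and $v_iz_i$ $(1\le i\le 2n)$, and $w_{2k-1}w_{2k}$ and $z_{2k-1}z_{2k}$ $(1\le k\le n)$.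 Let $G_0$ be the null graph, whose only perfect matching is empty. Theorem. For every integer $n\ge 0$, the sum of the anti-forcing numbers of all perfect matchings of $G_n$, $$A_n=\sum_{M}af(G_n,M)=\frac{d}{dx}Af(G_n,x)\Big|_{x=1},$$ is $$A_n=-3+\frac{150+67\sqrt5}{100}(3-\sqrt5)^n+\frac{29-10\sqrt5}{20}\,n(3-\sqrt5)^n+\frac{150-67\sqrt5}{100}(3+\sqrt5)^n+\frac{29+10\sqrt5}{20}\,n(3+\sqrt5)^n.$$ -/

import Mathlib

namespace SimpleGraph

/-- `S` is an anti-forcing set of the perfect matching `M` of `G`: it is a finite set of edges of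
`G` outside `M`, and `M` is the one and only perfect matching of `G - S`. (Perfect matchings of `G`
and of `G - S` are compared through their edge sets.) -/
def IsAntiForcingSet {V : Type*} (G : SimpleGraph V) (M : G.Subgraph) (S : Finset (Sym2 V)) :
    Prop :=
  (S : Set (Sym2 V)) ⊆ G.edgeSet \ M.edgeSet ∧
    ∀ N : (G.deleteEdges (S : Set (Sym2 V))).Subgraph,
      N.IsPerfectMatching ↔ N.edgeSet = M.edgeSet

/-- The anti-forcing number `af(G, M)`: the minimum size of an anti-forcing set of `M`. -/
noncomputable def antiForcingNumber {V : Type*} (G : SimpleGraph V) (M : G.Subgraph) : ℕ :=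
  sInf {k : ℕ | ∃ S : Finset (Sym2 V), G.IsAntiForcingSet M S ∧ S.card = k}

/-- The finite set of all perfect matchings of a graph with finitely many vertices. -/
noncomputable def perfectMatchings {V : Type*} [Finite V] (G : SimpleGraph V) :
    Finset G.Subgraph :=
  (Set.toFinite {M : G.Subgraph | M.IsPerfectMatching}).toFinset

/-- The anti-forcing polynomial `Af(G, x) = ∑ x ^ af(G, M)`, the sum being over all perfect
matchings `M` of `G`. -/
noncomputable def antiForcingPolynomial {V : Type*} [Finite V] (G : SimpleGraph V) :
    Polynomial ℝ :=
  ∑ M ∈ G.perfectMatchings, Polynomial.X ^ G.antiForcingNumber M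

end SimpleGraph

namespace Polyomino

/-- Labels for vertices, in four horizontal rows which are, from one side to the other,
`w`, `u`, `v`, `z`; the argument is the column. -/
inductive Label : Type
  | u (i : ℕ)
  | v (i : ℕ)
  | w (i : ℕ)
  | z (i : ℕ)

/-- The labels that occur in the `n`-th graph: `u₀, v₀` and `uᵢ, vᵢ, wᵢ, zᵢ` for `1 ≤ i ≤ 2n`.
For `n = 0` there are none, since `G₀` is the null graph. -/
def Label.Occurs (n : ℕ) : Label → Prop
  | .u i => 1 ≤ n ∧ i ≤ 2 * n
  | .v i => 1 ≤ n ∧ i ≤ 2 * n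
  | .w i => 1 ≤ i ∧ i ≤ 2 * n
  | .z i => 1 ≤ i ∧ i ≤ 2 * n

/-- The edges of the unit squares that make up the graph, each listed in one direction:
* `uᵢ vᵢ`, `uᵢ uᵢ₊₁`, `vᵢ vᵢ₊₁` bound the `2n` squares `uᵢ uᵢ₊₁ vᵢ₊₁ vᵢ` of the middle row;
* `wᵢ uᵢ` and `wᵢ wᵢ₊₁` with `i` odd bound the `n` squares `wᵢ wᵢ₊₁ uᵢ₊₁ uᵢ`, `i` odd;
* `vᵢ zᵢ` and `zᵢ zᵢ₊₁` with `i` odd bound the `n` squares `vᵢ vᵢ₊₁ zᵢ₊₁ zᵢ`, `i` odd. -/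
def Label.Edge : Label → Label → Prop
  | .u i, .v j => i = j
  | .u i, .u j => j = i + 1
  | .v i, .v j => j = i + 1
  | .w i, .u j => i = j
  | .w i, .w j => Odd i ∧ j = i + 1
  | .v i, .z j => i = j
  | .z i, .z j => Odd i ∧ j = i + 1
  | _, _ => False

/-- The vertices of the polyomino graph `Gₙ`. -/
abbrev Vertex (n : ℕ) : Type := {a : Label // a.Occurs n}

instance instFiniteVertex (n : ℕ) : Finite (Vertex n) := by
  refine Set.Finite.subset (s := Label.u '' Set.Iic (2 * n) ∪ Label.v '' Set.Iic (2 * n) ∪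
    Label.w '' Set.Iic (2 * n) ∪ Label.z '' Set.Iic (2 * n)) ?_ ?_
  · exact ((((Set.finite_Iic _).image _).union ((Set.finite_Iic _).image _)).union
      ((Set.finite_Iic _).image _)).union ((Set.finite_Iic _).image _)
  · rintro (i | i | i | i) h
    all_goals
      have h2 : i ≤ 2 * n := h.2
      simp [h2]

/-- The polyomino graph `Gₙ`, which consists of `4n` squares. -/
def G (n : ℕ) : SimpleGraph (Vertex n) :=
  SimpleGraph.fromRel fun a b => Label.Edge a.1 b.1

end Polyomino

/-! Cut the graph into `n` blocks of two columns each. By a parity argument carried along from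
column 0, a perfect matching contains both or neither of the two edges joining consecutive blocks.
Hence it is a word in eight tiles accepted by a two-state automaton (`isPerfectMatching_iff`). An
anti-forcing set of `M` is then a set of edges that avoids the word of `M` and meets every other
accepted word (`isAntiForcingSet_iff`).

A minimum such set comes from a greedy rule that reads `M` from left to right. In each block it
destroys at least the competitors that leave the block in the same state as `M`; one bit remembers
whether competitors in the other state may survive. Since nothing leaves the last block, survivors
die at the right end (`Mode.eq_of_avoids_cuts`). Optimality is an amortized argument:
`Mode.surcharge` is a potential comparing the mode of the greedy rule with what an arbitrary set
leaves alive. A finite local inequality, `Mode.card_cut_add_surcharge_le`, telescopes to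
`Mode.cost_add_surcharge_le`.

So `af` is an additive cost along the word (`antiForcingNumber_eq`), and its sums satisfy linear
recurrences. The words are counted by the matrix with rows (5, 1) and (1, 1), whose eigenvalues are
`3 ± √5`. The cost recurrences have these eigenvalues again, whence the terms `n (3 ± √5) ^ n`, and
the eigenvalue 1, whence the constant -3. -/

namespace Polyomino

/-! ### Blocks, tiles and accepted words -/

/-- The edges of a block, that is, of the two squares in columns `2k+1, 2k+2` outside the middle row
together with the middle squares between the columns `2k, 2k+1, 2k+2`: the edges `cu, cv` enter the
block from column `2k`, the other names are made of the letters of the rows of their ends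
(`r1, r2` being the vertical edges of the middle row). -/
inductive Slot : Type
  | cu | cv | uu | vv | r1 | r2 | ww | zz | w1 | w2 | z1 | z2
  deriving DecidableEq

instance : Fintype Slot where
  elems := {.cu, .cv, .uu, .vv, .r1, .r2, .ww, .zz, .w1, .w2, .z1, .z2}
  complete a := by cases a <;> decide

/-- The possible traces of a perfect matching on a block. -/
inductive Tile : Type
  | rungs | bars | wLegs | zLegs | legs | opening | closing | through
  deriving DecidableEq

instance : Fintype Tile where
  elems := {.rungs, .bars, .wLegs, .zLegs, .legs, .opening, .closing, .through}
  complete a := by cases a <;> decide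

namespace Tile

/-- The edges of the matching in the block. -/
def slots : Tile → Finset Slot
  | rungs => {.ww, .zz, .r1, .r2}
  | bars => {.ww, .zz, .uu, .vv}
  | wLegs => {.w1, .w2, .zz, .vv}
  | zLegs => {.ww, .uu, .z1, .z2}
  | legs => {.w1, .w2, .z1, .z2}
  | opening => {.ww, .zz, .r1}
  | closing => {.ww, .zz, .cu, .cv, .r2}
  | through => {.ww, .zz, .cu, .cv}

/-- Whether the matching contains the two edges that enter the block from the left. -/
def src : Tile → Bool
  | closing | through => true
  | _ => false

/-- Whether the matching contains the two edges that leave the block to the right. -/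
def tgt : Tile → Bool
  | opening | through => true
  | _ => false

theorem slots_injective : Function.Injective slots := by decide

end Tile

/-- `Accepted s w`: the tiles of `w` fit together, starting with `s` and with nothing leaving
the last tile. -/
def Accepted : Bool → List Tile → Prop
  | s, [] => s = false
  | s, l :: w => l.src = s ∧ Accepted l.tgt w

/-- The tile in position `k` of the word uses the edge `e` of its block. -/
def Uses (w : List Tile) (k : ℕ) (e : Slot) : Prop :=
  ∃ l, w[k]? = some l ∧ e ∈ l.slots

@[simp] theorem uses_cons_zero {l : Tile} {w : List Tile} {e : Slot} :
    Uses (l :: w) 0 e ↔ e ∈ l.slots := by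
  simp [Uses]

@[simp] theorem uses_cons_succ {l : Tile} {w : List Tile} {k : ℕ} {e : Slot} :
    Uses (l :: w) (k + 1) e ↔ Uses w k e := by
  simp [Uses]

/-! ### The greedy anti-forcing set -/

/-- The memory of the greedy construction of an anti-forcing set, read from left to right. The
first letter tells whether the given matching crosses to the next block, and the mode is open if
some other partial matching, which differs in this respect, has not been destroyed. -/
inductive Mode : Type
  | freeOpen | freeClosed | linkOpen | linkClosed
  deriving DecidableEq

instance : Fintype Mode where
  elems := {.freeOpen, .freeClosed, .linkOpen, .linkClosed}
  complete a := by cases a <;> decide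

namespace Mode

def linked : Mode → Bool
  | linkOpen | linkClosed => true
  | _ => false

def isOpen : Mode → Bool
  | freeOpen | linkOpen => true
  | _ => false

/-- The edges of a block with the given trace that are put into the anti-forcing set. -/
def cut : Mode → Tile → Finset Slot
  | freeOpen, .rungs => {.cu, .w1, .uu}
  | _, .rungs => {.w1, .uu}
  | freeOpen, .bars => {.w1, .z1, .r2}
  | _, .bars => {.w1, .z1, .r1}
  | _, .wLegs => {.ww, .z1}
  | _, .zLegs => {.zz, .w1}
  | _, .legs => {.ww, .zz}
  | freeOpen, .opening => {.cu}
  | _, .opening => ∅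
  | linkClosed, .closing => ∅
  | _, .closing => {.w1, .uu, .r1}
  | linkClosed, .through => {.r2}
  | _, .through => {.r1}

/-- The mode after a block with the given trace. -/
def next : Mode → Tile → Mode
  | freeOpen, .bars => freeOpen
  | _, .bars => freeClosed
  | _, .rungs => freeOpen
  | _, .wLegs | _, .zLegs | _, .legs => freeClosed
  | _, .opening => linkOpen
  | _, .closing => freeOpen
  | linkClosed, .through => linkClosed
  | _, .through => linkOpen

theorem linked_next (q : Mode) (l : Tile) (h : l.src = q.linked) :
    (q.next l).linked = l.tgt := by
  revert q l; decide

theorem disjoint_cut (q : Mode) (l : Tile) (h : l.src = q.linked) :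
    Disjoint l.slots (q.cut l) := by
  revert q l; decide

/-- The invariant of the greedy rule: a competitor that survives a block either copies the tile of
the matching or leaves in the other state, and then the new mode is open. -/
theorem eq_or_open_of_disjoint_cut (q : Mode) (l l' : Tile) (h : l.src = q.linked)
    (h' : l'.src = q.linked ∨ q.isOpen) (hd : Disjoint l'.slots (q.cut l)) :
    l' = l ∨ l'.tgt ≠ l.tgt ∧ (q.next l).isOpen := by
  revert q l l'; decide

/-- The edges put into the anti-forcing set in position `k`. -/
def cuts : Mode → List Tile → ℕ → Finset Slot
  | _, [], _ => ∅
  | q, l :: _, 0 => q.cut l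
  | q, l :: w, k + 1 => cuts (q.next l) w k

/-- The size of the anti-forcing set. -/
def cost : Mode → List Tile → ℕ
  | _, [] => 0
  | q, l :: w => (q.cut l).card + cost (q.next l) w

theorem sum_card_cuts (w : List Tile) (q : Mode) :
    ∑ k ∈ Finset.range w.length, (q.cuts w k).card = q.cost w := by
  induction w generalizing q with
  | nil => rfl
  | cons l w ih =>
    rw [List.length_cons, Finset.sum_range_succ', cost, ← ih (q.next l), add_comm]
    rfl

theorem not_mem_cuts_of_uses {w : List Tile} {q : Mode} (hw : Accepted q.linked w) {k : ℕ}
    {e : Slot} (h : Uses w k e) : e ∉ q.cuts w k := by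
  induction w generalizing q k with
  | nil => simp [Uses] at h
  | cons l w ih =>
    cases k with
    | zero => exact Finset.disjoint_left.1 (disjoint_cut q l hw.1) (uses_cons_zero.1 h)
    | succ k =>
      exact ih (q := q.next l) (by rw [linked_next q l hw.1]; exact hw.2) (uses_cons_succ.1 h)

/-- Competitors in the other state may survive for a while, but both words must end in state
`false`, so the difference cannot persist. -/
theorem eq_of_avoids_cuts {w y : List Tile} {q : Mode} {s : Bool} (hw : Accepted q.linked w)
    (hy : Accepted s y) (hlen : y.length = w.length) (hs : s = q.linked ∨ q.isOpen)
    (h : ∀ k e, Uses y k e → e ∉ q.cuts w k) : y = w := by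
  -- Equality of the states is what excludes, one block earlier, a competitor that left in the other
  -- state.
  suffices y = w ∧ s = q.linked from this.1
  induction w generalizing y q s with
  | nil =>
    obtain rfl : y = [] := by simpa using hlen
    exact ⟨rfl, hy.trans hw.symm⟩
  | cons l w ih =>
    obtain _ | ⟨l', y⟩ := y
    · simp at hlen
    obtain ⟨hl, hw⟩ := hw
    obtain ⟨hl', hy⟩ := hy
    subst hl'
    have hd : Disjoint l'.slots (q.cut l) :=
      Finset.disjoint_left.2 fun e he => h 0 e (uses_cons_zero.2 he)
    have hq := linked_next q l hl
    have key := eq_or_open_of_disjoint_cut q l l' hl hs hd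
    have := ih (q := q.next l) (by rwa [hq]) hy (by simpa using hlen)
      (key.imp (fun e => by rw [e, hq]) fun e => e.2)
      fun k e he => h (k + 1) e (uses_cons_succ.2 he)
    obtain ⟨rfl, ht⟩ := this
    rcases key with rfl | ⟨h1, -⟩
    · exact ⟨rfl, hl⟩
    · exact absurd (ht.trans hq) h1

/-! ### Optimality of the greedy set -/

/-- What has to be added to the cost of the remaining blocks if the alternatives that arrive in the
other state are (or are not) to be destroyed as well. -/
def surcharge : Mode → Bool → ℤ
  | freeOpen, false => -1
  | linkOpen, false => -3
  | linkClosed, true => 1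
  | _, _ => 0

/-- Here `x` is the weight that an arbitrary set puts on the block, and `o`, `o'` tell whether it
leaves competitors in the other state alive before and after. The potential makes early extra cuts
pay for later savings: without live competitors `freeOpen` overpays by at most 1, and `linkOpen` by
the 3 edges it cuts at `closing`. For `linkClosed` the value 1 is not sharp, but it matches the
price of cutting `u₀v₀`. -/
theorem card_cut_add_surcharge_le (q : Mode) (l : Tile) (o o' : Bool) (x : Slot → ℕ)
    (hl : l.src = q.linked) (h0 : ∀ e ∈ l.slots, x e = 0)
    (h1 : ∀ l', l' ≠ l → (l'.src = q.linked ∨ o) → (l'.tgt = l.tgt ∨ !o') →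
      1 ≤ ∑ e ∈ l'.slots, x e) :
    ((q.cut l).card : ℤ) + q.surcharge o ≤ ∑ e, (x e : ℤ) + (q.next l).surcharge o' := by
  have hx : ∑ e, (x e : ℤ) = x .cu + x .cv + x .uu + x .vv + x .r1 + x .r2 + x .ww + x .zz
      + x .w1 + x .w2 + x .z1 + x .z2 := by
    rw [show (Finset.univ : Finset Slot) = {.cu, .cv, .uu, .vv, .r1, .r2, .ww, .zz, .w1, .w2,
      .z1, .z2} from by decide]
    simp [add_assoc]
  rw [hx]
  have a1 := h1 .rungs
  have a2 := h1 .bars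
  have a3 := h1 .wLegs
  have a4 := h1 .zLegs
  have a5 := h1 .legs
  have a6 := h1 .opening
  have a7 := h1 .closing
  have a8 := h1 .through
  clear h1 hx
  simp [Tile.slots] at a1 a2 a3 a4 a5 a6 a7 a8
  cases q <;> cases o <;> cases o' <;> cases l <;> first | exact absurd hl (by decide) | skip
  all_goals
    clear hl
    simp [Tile.src, Tile.tgt, linked] at a1 a2 a3 a4 a5 a6 a7 a8
    simp [Tile.slots] at h0
    simp [cut, next, surcharge]
    omega

/-- The local inequalities telescope, because the bit `o'` of one block is the bit `o` of the next.
-/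
theorem cost_add_surcharge_le {w : List Tile} {q : Mode} (o : Bool) {x : ℕ → Slot → ℕ}
    (hw : Accepted q.linked w) (h0 : ∀ k e, Uses w k e → x k e = 0)
    (h1 : ∀ s y, Accepted s y → y.length = w.length → (s = q.linked ∨ o) →
      (s ≠ q.linked ∨ y ≠ w) → ∃ k e, Uses y k e ∧ x k e ≠ 0) :
    (q.cost w : ℤ) + q.surcharge o ≤ ∑ k ∈ Finset.range w.length, ∑ e, (x k e : ℤ) := by
  induction w generalizing q o x with
  | nil =>
    have hq : q.linked = false := hw
    -- The final mode is free, where no surcharge is positive.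
    cases q <;> simp [linked] at hq <;> cases o <;> simp [cost, surcharge]
  | cons l w ih =>
    obtain ⟨hl, hw⟩ := hw
    have hq := linked_next q l hl
    -- True when an unhit tile leads to the other state.
    let o' : Bool := decide (∃ l', l' ≠ l ∧ (l'.src = q.linked ∨ o) ∧ l'.tgt ≠ l.tgt ∧
      ∀ e ∈ l'.slots, x 0 e = 0)
    have step : ∀ l' y, (l'.src = q.linked ∨ o) → Accepted l'.tgt y → y.length = w.length →
        (l' ≠ l ∨ y ≠ w) → (∀ e ∈ l'.slots, x 0 e = 0) →
        ∃ k e, Uses y k e ∧ x (k + 1) e ≠ 0 := by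
      intro l' y hs hy hlen hne hz
      obtain ⟨k, e, hk, hx⟩ := h1 l'.src (l' :: y) ⟨rfl, hy⟩ (by simpa using hlen) hs
        (Or.inr (by simpa [imp_iff_not_or] using hne))
      cases k with
      | zero => exact absurd (hz e (uses_cons_zero.1 hk)) hx
      | succ k => exact ⟨k, e, uses_cons_succ.1 hk, hx⟩
    have hz : ∀ e ∈ l.slots, x 0 e = 0 := fun e he => h0 0 e (uses_cons_zero.2 he)
    have hrest := ih (q := q.next l) o' (x := fun k => x (k + 1)) (by rwa [hq])
      (fun k e he => h0 (k + 1) e (uses_cons_succ.2 he)) (by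
        intro s y hy hlen hs hne
        rw [hq] at hs hne
        by_cases hsl : s = l.tgt
        · subst hsl
          exact step l y (Or.inl hl) hy hlen (Or.inr (hne.resolve_left (by simp))) hz
        · obtain ⟨l', hl', hs', ht, hz'⟩ := of_decide_eq_true (hs.resolve_left hsl)
          have : l'.tgt = s := by
            revert hsl ht; cases s <;> cases l.tgt <;> cases l'.tgt <;> simp
          exact step l' y hs' (this ▸ hy) hlen (Or.inl hl') hz')
    have hloc := card_cut_add_surcharge_le q l o o' (x 0) hl hz (by
      intro l' hl' hs ht
      -- An unhit tile with the same exit as `l`, continued by `w` itself, would be an unhit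
      -- competitor.
      by_contra hlt
      have hz' : ∀ e ∈ l'.slots, x 0 e = 0 := by
        simpa [Finset.sum_eq_zero_iff] using hlt
      have htt : l'.tgt = l.tgt := by
        by_contra hcon
        have : o' = true := decide_eq_true ⟨l', hl', hs, hcon, hz'⟩
        simp [this, hcon] at ht
      obtain ⟨k, e, hk, hx⟩ := step l' w hs (htt ▸ hw) rfl (Or.inl hl') hz'
      exact hx (h0 (k + 1) e (uses_cons_succ.2 hk)))
    rw [List.length_cons, Finset.sum_range_succ', cost]
    push_cast at hrest hloc ⊢
    linarith

end Mode

/-! ### Edge names and the adjacency of the graph -/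

/-- Names of the edges: `base` is `u₀v₀`, the other edges are sorted by blocks. -/
inductive EdgeName : Type
  | base
  | block (k : ℕ) (e : Slot)
  deriving DecidableEq

namespace EdgeName

def fst : EdgeName → Label
  | base => .u 0
  | block k .cu => .u (2 * k)
  | block k .cv => .v (2 * k)
  | block k .uu => .u (2 * k + 1)
  | block k .vv => .v (2 * k + 1)
  | block k .r1 => .u (2 * k + 1)
  | block k .r2 => .u (2 * k + 2)
  | block k .ww => .w (2 * k + 1)
  | block k .zz => .z (2 * k + 1)
  | block k .w1 => .w (2 * k + 1)
  | block k .w2 => .w (2 * k + 2)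
  | block k .z1 => .v (2 * k + 1)
  | block k .z2 => .v (2 * k + 2)

def snd : EdgeName → Label
  | base => .v 0
  | block k .cu => .u (2 * k + 1)
  | block k .cv => .v (2 * k + 1)
  | block k .uu => .u (2 * k + 2)
  | block k .vv => .v (2 * k + 2)
  | block k .r1 => .v (2 * k + 1)
  | block k .r2 => .v (2 * k + 2)
  | block k .ww => .w (2 * k + 2)
  | block k .zz => .z (2 * k + 2)
  | block k .w1 => .u (2 * k + 1)
  | block k .w2 => .u (2 * k + 2)
  | block k .z1 => .z (2 * k + 1)
  | block k .z2 => .z (2 * k + 2)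

/-- The unordered pair of labels named by an edge name. -/
def toSym2 (ε : EdgeName) : Sym2 Label := s(ε.fst, ε.snd)

theorem edge_fst_snd (ε : EdgeName) : Label.Edge ε.fst ε.snd := by
  rcases ε with _ | ⟨k, _ | _⟩ <;> simp [fst, snd, Label.Edge]

theorem fst_ne_snd (ε : EdgeName) : ε.fst ≠ ε.snd := by
  rcases ε with _ | ⟨k, _ | _⟩ <;> simp [fst, snd]

theorem toSym2_injective : Function.Injective toSym2 := by
  rintro (_ | ⟨k, _ | _⟩) (_ | ⟨j, _ | _⟩) h <;>
    simp [toSym2, fst, snd] at h ⊢ <;> omega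

/-- The edges that exist in the `n`-th graph. -/
def Valid (n : ℕ) : EdgeName → Prop
  | base => 1 ≤ n
  | block k _ => k < n

theorem Valid.occurs {n : ℕ} {ε : EdgeName} (h : ε.Valid n) :
    ε.fst.Occurs n ∧ ε.snd.Occurs n := by
  rcases ε with _ | ⟨k, _ | _⟩ <;> simp [fst, snd, Label.Occurs, Valid] at h ⊢ <;> omega

end EdgeName

open EdgeName

theorem eq_zero_or_odd_or_even_pos (i : ℕ) :
    i = 0 ∨ (∃ k, i = 2 * k + 1) ∨ ∃ k, i = 2 * k + 2 := by
  rcases Nat.even_or_odd' i with ⟨_ | k, rfl | rfl⟩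
  · exact Or.inl rfl
  · exact Or.inr (Or.inl ⟨0, rfl⟩)
  · exact Or.inr (Or.inr ⟨k, by ring⟩)
  · exact Or.inr (Or.inl ⟨k + 1, rfl⟩)

theorem Label.Edge.exists_edgeName {n : ℕ} {a b : Label} (h : Label.Edge a b)
    (ha : a.Occurs n) (hb : b.Occurs n) :
    ∃ ε : EdgeName, ε.Valid n ∧ ε.toSym2 = s(a, b) := by
  rcases a with i | i | i | i <;> rcases b with j | j | j | j <;>
    simp only [Label.Edge, Label.Occurs] at h ha hb
  · subst h
    rcases Nat.even_or_odd' i with ⟨k, rfl | rfl⟩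
    · exact ⟨block k .cu, by simp only [Valid]; omega, rfl⟩
    · exact ⟨block k .uu, by simp only [Valid]; omega, rfl⟩
  · subst h
    rcases eq_zero_or_odd_or_even_pos i with rfl | ⟨k, rfl⟩ | ⟨k, rfl⟩
    · exact ⟨base, ha.1, rfl⟩
    · exact ⟨block k .r1, by simp only [Valid]; omega, rfl⟩
    · exact ⟨block k .r2, by simp only [Valid]; omega, rfl⟩
  · subst h
    rcases Nat.even_or_odd' i with ⟨k, rfl | rfl⟩
    · exact ⟨block k .cv, by simp only [Valid]; omega, rfl⟩
    · exact ⟨block k .vv, by simp only [Valid]; omega, rfl⟩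
  · subst h
    rcases eq_zero_or_odd_or_even_pos i with rfl | ⟨k, rfl⟩ | ⟨k, rfl⟩
    · omega
    · exact ⟨block k .z1, by simp only [Valid]; omega, rfl⟩
    · exact ⟨block k .z2, by simp only [Valid]; omega, rfl⟩
  · subst h
    rcases eq_zero_or_odd_or_even_pos i with rfl | ⟨k, rfl⟩ | ⟨k, rfl⟩
    · omega
    · exact ⟨block k .w1, by simp only [Valid]; omega, rfl⟩
    · exact ⟨block k .w2, by simp only [Valid]; omega, rfl⟩
  · obtain ⟨⟨k, rfl⟩, rfl⟩ := h
    exact ⟨block k .ww, by simp only [Valid]; omega, rfl⟩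
  · obtain ⟨⟨k, rfl⟩, rfl⟩ := h
    exact ⟨block k .zz, by simp only [Valid]; omega, rfl⟩

theorem G_adj_iff {n : ℕ} {a b : Vertex n} :
    (G n).Adj a b ↔ ∃ ε : EdgeName, ε.Valid n ∧ ε.toSym2 = s(a.1, b.1) := by
  rw [G, SimpleGraph.fromRel_adj]
  constructor
  · rintro ⟨-, h | h⟩
    · exact h.exists_edgeName a.2 b.2
    · rw [Sym2.eq_swap]
      exact h.exists_edgeName b.2 a.2
  · rintro ⟨ε, -, h⟩
    have hne := ε.fst_ne_snd
    have he := ε.edge_fst_snd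
    rcases Sym2.eq_iff.1 h with ⟨h1, h2⟩ | ⟨h1, h2⟩ <;> rw [h1, h2] at hne he
    · exact ⟨fun h => hne (congrArg _ h), Or.inl he⟩
    · exact ⟨fun h => hne (congrArg _ h.symm), Or.inr he⟩

/-- Adjacency by an edge whose name satisfies `F`. -/
def Rel (F : EdgeName → Prop) (a b : Label) : Prop :=
  ∃ ε, F ε ∧ ε.toSym2 = s(a, b)

theorem rel_fst_snd {F : EdgeName → Prop} {ε : EdgeName} : Rel F ε.fst ε.snd ↔ F ε :=
  ⟨fun ⟨_, h, he⟩ => toSym2_injective he ▸ h, fun h => ⟨ε, h, rfl⟩⟩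

/-! ### The edges at each vertex -/

section Neighbors

variable {F : EdgeName → Prop} {k : ℕ} {b : Label}

theorem rel_u_zero : Rel F (.u 0) b ↔
    F (base) ∧ b = .v 0 ∨
      F (block 0 .cu) ∧ b = .u 1 := by
  constructor
  · rintro ⟨_ | ⟨j, _ | _⟩, h, he⟩ <;> simp [toSym2, fst, snd] at he
    all_goals grind
  · rintro (⟨h, rfl⟩ | ⟨h, rfl⟩)
    exacts [⟨_, h, rfl⟩, ⟨_, h, rfl⟩]

theorem rel_v_zero : Rel F (.v 0) b ↔
    F (base) ∧ b = .u 0 ∨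
      F (block 0 .cv) ∧ b = .v 1 := by
  constructor
  · rintro ⟨_ | ⟨j, _ | _⟩, h, he⟩ <;> simp [toSym2, fst, snd] at he
    all_goals grind
  · rintro (⟨h, rfl⟩ | ⟨h, rfl⟩)
    exacts [⟨_, h, Sym2.eq_swap⟩, ⟨_, h, rfl⟩]

theorem rel_w_odd : Rel F (.w (2 * k + 1)) b ↔
    F (block k .ww) ∧ b = .w (2 * k + 2) ∨
      F (block k .w1) ∧ b = .u (2 * k + 1) := by
  constructor
  · rintro ⟨_ | ⟨j, _ | _⟩, h, he⟩ <;> simp [toSym2, fst, snd] at he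
    all_goals grind
  · rintro (⟨h, rfl⟩ | ⟨h, rfl⟩)
    exacts [⟨_, h, rfl⟩, ⟨_, h, rfl⟩]

theorem rel_w_even : Rel F (.w (2 * k + 2)) b ↔
    F (block k .ww) ∧ b = .w (2 * k + 1) ∨
      F (block k .w2) ∧ b = .u (2 * k + 2) := by
  constructor
  · rintro ⟨_ | ⟨j, _ | _⟩, h, he⟩ <;> simp [toSym2, fst, snd] at he
    all_goals grind
  · rintro (⟨h, rfl⟩ | ⟨h, rfl⟩)
    exacts [⟨_, h, Sym2.eq_swap⟩, ⟨_, h, rfl⟩]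

theorem rel_z_odd : Rel F (.z (2 * k + 1)) b ↔
    F (block k .zz) ∧ b = .z (2 * k + 2) ∨
      F (block k .z1) ∧ b = .v (2 * k + 1) := by
  constructor
  · rintro ⟨_ | ⟨j, _ | _⟩, h, he⟩ <;> simp [toSym2, fst, snd] at he
    all_goals grind
  · rintro (⟨h, rfl⟩ | ⟨h, rfl⟩)
    exacts [⟨_, h, rfl⟩, ⟨_, h, Sym2.eq_swap⟩]

theorem rel_z_even : Rel F (.z (2 * k + 2)) b ↔
    F (block k .zz) ∧ b = .z (2 * k + 1) ∨
      F (block k .z2) ∧ b = .v (2 * k + 2) := by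
  constructor
  · rintro ⟨_ | ⟨j, _ | _⟩, h, he⟩ <;> simp [toSym2, fst, snd] at he
    all_goals grind
  · rintro (⟨h, rfl⟩ | ⟨h, rfl⟩)
    exacts [⟨_, h, Sym2.eq_swap⟩, ⟨_, h, Sym2.eq_swap⟩]

theorem rel_u_odd : Rel F (.u (2 * k + 1)) b ↔
    F (block k .cu) ∧ b = .u (2 * k) ∨
      F (block k .w1) ∧ b = .w (2 * k + 1) ∨
      F (block k .uu) ∧ b = .u (2 * k + 2) ∨
      F (block k .r1) ∧ b = .v (2 * k + 1) := by
  constructor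
  · rintro ⟨_ | ⟨j, _ | _⟩, h, he⟩ <;> simp [toSym2, fst, snd] at he
    all_goals grind
  · rintro (⟨h, rfl⟩ | ⟨h, rfl⟩ | ⟨h, rfl⟩ | ⟨h, rfl⟩)
    exacts [⟨_, h, Sym2.eq_swap⟩, ⟨_, h, Sym2.eq_swap⟩, ⟨_, h, rfl⟩, ⟨_, h, rfl⟩]

theorem rel_v_odd : Rel F (.v (2 * k + 1)) b ↔
    F (block k .cv) ∧ b = .v (2 * k) ∨
      F (block k .z1) ∧ b = .z (2 * k + 1) ∨
      F (block k .vv) ∧ b = .v (2 * k + 2) ∨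
      F (block k .r1) ∧ b = .u (2 * k + 1) := by
  constructor
  · rintro ⟨_ | ⟨j, _ | _⟩, h, he⟩ <;> simp [toSym2, fst, snd] at he
    all_goals grind
  · rintro (⟨h, rfl⟩ | ⟨h, rfl⟩ | ⟨h, rfl⟩ | ⟨h, rfl⟩)
    exacts [⟨_, h, Sym2.eq_swap⟩, ⟨_, h, rfl⟩, ⟨_, h, rfl⟩, ⟨_, h, Sym2.eq_swap⟩]

theorem rel_u_even : Rel F (.u (2 * k + 2)) b ↔
    F (block (k + 1) .cu) ∧ b = .u (2 * k + 3) ∨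
      F (block k .w2) ∧ b = .w (2 * k + 2) ∨
      F (block k .uu) ∧ b = .u (2 * k + 1) ∨
      F (block k .r2) ∧ b = .v (2 * k + 2) := by
  constructor
  · rintro ⟨_ | ⟨j, _ | _⟩, h, he⟩ <;> simp [toSym2, fst, snd] at he
    all_goals grind
  · rintro (⟨h, rfl⟩ | ⟨h, rfl⟩ | ⟨h, rfl⟩ | ⟨h, rfl⟩)
    exacts [⟨_, h, rfl⟩, ⟨_, h, Sym2.eq_swap⟩, ⟨_, h, Sym2.eq_swap⟩, ⟨_, h, rfl⟩]

theorem rel_v_even : Rel F (.v (2 * k + 2)) b ↔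
    F (block (k + 1) .cv) ∧ b = .v (2 * k + 3) ∨
      F (block k .z2) ∧ b = .z (2 * k + 2) ∨
      F (block k .vv) ∧ b = .v (2 * k + 1) ∨
      F (block k .r2) ∧ b = .u (2 * k + 2) := by
  constructor
  · rintro ⟨_ | ⟨j, _ | _⟩, h, he⟩ <;> simp [toSym2, fst, snd] at he
    all_goals grind
  · rintro (⟨h, rfl⟩ | ⟨h, rfl⟩ | ⟨h, rfl⟩ | ⟨h, rfl⟩)
    exacts [⟨_, h, rfl⟩, ⟨_, h, rfl⟩, ⟨_, h, Sym2.eq_swap⟩, ⟨_, h, Sym2.eq_swap⟩]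

end Neighbors

/-! ### Perfect matchings as words of tiles -/

/-- Exactly one of two propositions holds. -/
def One₂ (p q : Prop) : Prop := (p ∨ q) ∧ ¬(p ∧ q)

/-- Exactly one of four propositions holds. -/
def One₄ (p q r s : Prop) : Prop :=
  (p ∨ q ∨ r ∨ s) ∧ ¬(p ∧ q) ∧ ¬(p ∧ r) ∧ ¬(p ∧ s) ∧ ¬(q ∧ r) ∧ ¬(q ∧ s) ∧ ¬(r ∧ s)

theorem existsUnique_iff_one₂ {α : Type*} {p q : Prop} {a b : α} (hab : a ≠ b) :
    (∃! x, p ∧ x = a ∨ q ∧ x = b) ↔ One₂ p q := by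
  unfold One₂ ExistsUnique
  by_cases p <;> by_cases q <;> simp_all
  exact fun h => absurd h.symm hab

theorem existsUnique_iff_one₄ {α : Type*} {p q r s : Prop} {a b c d : α} (h : [a, b, c, d].Nodup) :
    (∃! x, p ∧ x = a ∨ q ∧ x = b ∨ r ∧ x = c ∨ s ∧ x = d) ↔ One₄ p q r s := by
  simp only [List.nodup_cons, List.mem_cons, not_or] at h
  unfold One₄
  constructor
  · rintro ⟨x, hx, hu⟩
    have ha : p → a = x := fun hp => hu a (by simp [hp])
    have hb : q → b = x := fun hp => hu b (by simp [hp])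
    have hc : r → c = x := fun hp => hu c (by simp [hp])
    have hd : s → d = x := fun hp => hu d (by simp [hp])
    grind
  · rintro ⟨hp | hp | hp | hp, h'⟩
    · exact ⟨a, by simp [hp], by grind⟩
    · exact ⟨b, by simp [hp], by grind⟩
    · exact ⟨c, by simp [hp], by grind⟩
    · exact ⟨d, by simp [hp], by grind⟩

/-- The conditions for the edges `f` to contain exactly one edge at each vertex of a block, where
`c` and `d` tell whether the two edges that leave the block to the right are present. -/
def BlockCovered (f : Slot → Prop) (c d : Prop) : Prop :=
  One₂ (f .ww) (f .w1) ∧ One₂ (f .ww) (f .w2) ∧ One₂ (f .zz) (f .z1) ∧ One₂ (f .zz) (f .z2) ∧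
    One₄ (f .cu) (f .w1) (f .uu) (f .r1) ∧ One₄ (f .cv) (f .z1) (f .vv) (f .r1) ∧
    One₄ c (f .w2) (f .uu) (f .r2) ∧ One₄ d (f .z2) (f .vv) (f .r2)

theorem Tile.blockCovered (l : Tile) :
    BlockCovered (· ∈ l.slots) (l.tgt = true) (l.tgt = true) := by
  cases l <;> simp [BlockCovered, One₂, One₄, slots, tgt]

/-- Once the entering edges agree, `cu`, `ww`, `zz`, `uu` and `c` decide all other edges of the
block, and the leaving edges agree again. This last point keeps the induction over blocks going. -/
theorem BlockCovered.exists_tile {f : Slot → Prop} {c d : Prop} (h : BlockCovered f c d)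
    (hf : f .cu ↔ f .cv) :
    ∃ l : Tile, (∀ e, f e ↔ e ∈ l.slots) ∧ (c ↔ l.tgt = true) ∧ (d ↔ l.tgt = true) := by
  have all : ∀ l : Tile, ((f .cu ↔ .cu ∈ l.slots) ∧ (f .cv ↔ .cv ∈ l.slots) ∧
      (f .uu ↔ .uu ∈ l.slots) ∧ (f .vv ↔ .vv ∈ l.slots) ∧ (f .r1 ↔ .r1 ∈ l.slots) ∧
      (f .r2 ↔ .r2 ∈ l.slots) ∧ (f .ww ↔ .ww ∈ l.slots) ∧ (f .zz ↔ .zz ∈ l.slots) ∧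
      (f .w1 ↔ .w1 ∈ l.slots) ∧ (f .w2 ↔ .w2 ∈ l.slots) ∧ (f .z1 ↔ .z1 ∈ l.slots) ∧
      (f .z2 ↔ .z2 ∈ l.slots)) → ∀ e, f e ↔ e ∈ l.slots := by
    rintro l ⟨h1, h2, h3, h4, h5, h6, h7, h8, h9, h10, h11, h12⟩ (_ | _) <;> assumption
  unfold BlockCovered One₂ One₄ at h
  by_cases hcu : f .cu
  · by_cases hc : c
    · exact ⟨.through, all _ (by simp [Tile.slots]; grind), by simp [Tile.tgt]; grind⟩
    · exact ⟨.closing, all _ (by simp [Tile.slots]; grind), by simp [Tile.tgt]; grind⟩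
  · by_cases hww : f .ww
    · by_cases hzz : f .zz
      · by_cases huu : f .uu
        · exact ⟨.bars, all _ (by simp [Tile.slots]; grind), by simp [Tile.tgt]; grind⟩
        · by_cases hc : c
          · exact ⟨.opening, all _ (by simp [Tile.slots]; grind), by simp [Tile.tgt]; grind⟩
          · exact ⟨.rungs, all _ (by simp [Tile.slots]; grind), by simp [Tile.tgt]; grind⟩
      · exact ⟨.zLegs, all _ (by simp [Tile.slots]; grind), by simp [Tile.tgt]; grind⟩
    · by_cases hzz : f .zz
      · exact ⟨.wLegs, all _ (by simp [Tile.slots]; grind), by simp [Tile.tgt]; grind⟩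
      · exact ⟨.legs, all _ (by simp [Tile.slots]; grind), by simp [Tile.tgt]; grind⟩

/-- The conditions for the edges `F` to contain exactly one edge at each vertex. -/
def Covered (n : ℕ) (F : EdgeName → Prop) : Prop :=
  (1 ≤ n → One₂ (F base) (F (block 0 .cu)) ∧ One₂ (F base) (F (block 0 .cv))) ∧
    ∀ k < n, BlockCovered (fun e => F (block k e)) (F (block (k + 1) .cu)) (F (block (k + 1) .cv))

theorem covered_iff {n : ℕ} {F : EdgeName → Prop} :
    Covered n F ↔ ∀ a : Label, a.Occurs n → ∃! b, Rel F a b := by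
  have hu : ∀ k, (∃! b, Rel F (.u (2 * k + 1)) b) ↔ _ := fun k => by
    simp only [rel_u_odd]; exact existsUnique_iff_one₄ (by simp)
  have hv : ∀ k, (∃! b, Rel F (.v (2 * k + 1)) b) ↔ _ := fun k => by
    simp only [rel_v_odd]; exact existsUnique_iff_one₄ (by simp)
  have hu' : ∀ k, (∃! b, Rel F (.u (2 * k + 2)) b) ↔ _ := fun k => by
    simp only [rel_u_even]; exact existsUnique_iff_one₄ (by simp)
  have hv' : ∀ k, (∃! b, Rel F (.v (2 * k + 2)) b) ↔ _ := fun k => by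
    simp only [rel_v_even]; exact existsUnique_iff_one₄ (by simp)
  have hw : ∀ k, (∃! b, Rel F (.w (2 * k + 1)) b) ↔ _ := fun k => by
    simp only [rel_w_odd]; exact existsUnique_iff_one₂ (by simp)
  have hw' : ∀ k, (∃! b, Rel F (.w (2 * k + 2)) b) ↔ _ := fun k => by
    simp only [rel_w_even]; exact existsUnique_iff_one₂ (by simp)
  have hz : ∀ k, (∃! b, Rel F (.z (2 * k + 1)) b) ↔ _ := fun k => by
    simp only [rel_z_odd]; exact existsUnique_iff_one₂ (by simp)
  have hz' : ∀ k, (∃! b, Rel F (.z (2 * k + 2)) b) ↔ _ := fun k => by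
    simp only [rel_z_even]; exact existsUnique_iff_one₂ (by simp)
  have hu0 : (∃! b, Rel F (.u 0) b) ↔ One₂ (F base) (F (block 0 .cu)) := by
    simp only [rel_u_zero]; exact existsUnique_iff_one₂ (by simp)
  have hv0 : (∃! b, Rel F (.v 0) b) ↔ One₂ (F base) (F (block 0 .cv)) := by
    simp only [rel_v_zero]; exact existsUnique_iff_one₂ (by simp)
  constructor
  · rintro ⟨h0, h⟩ a ha
    rcases a with i | i | i | i <;> rcases eq_zero_or_odd_or_even_pos i with rfl | ⟨k, rfl⟩ | ⟨k, rfl⟩ <;>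
      simp only [Label.Occurs] at ha
    · exact hu0.2 (h0 (by omega)).1
    · obtain ⟨_, _, _, _, h5, h6, h7, h8⟩ := h k (by omega)
      exact (hu k).2 h5
    · obtain ⟨_, _, _, _, h5, h6, h7, h8⟩ := h k (by omega)
      exact (hu' k).2 h7
    · exact hv0.2 (h0 (by omega)).2
    · obtain ⟨_, _, _, _, h5, h6, h7, h8⟩ := h k (by omega)
      exact (hv k).2 h6
    · obtain ⟨_, _, _, _, h5, h6, h7, h8⟩ := h k (by omega)
      exact (hv' k).2 h8
    · omega
    · exact (hw k).2 (h k (by omega)).1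
    · exact (hw' k).2 (h k (by omega)).2.1
    · omega
    · exact (hz k).2 (h k (by omega)).2.2.1
    · exact (hz' k).2 (h k (by omega)).2.2.2.1
  · intro h
    refine ⟨fun hn => ⟨hu0.1 (h _ ?_), hv0.1 (h _ ?_)⟩, fun k hk => ⟨(hw k).1 (h _ ?_),
      (hw' k).1 (h _ ?_), (hz k).1 (h _ ?_), (hz' k).1 (h _ ?_), (hu k).1 (h _ ?_),
      (hv k).1 (h _ ?_), (hu' k).1 (h _ ?_), (hv' k).1 (h _ ?_)⟩⟩ <;>
    simp only [Label.Occurs] <;> omega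

/-- The edges of the matching which a word of tiles describes. -/
def wordEdges (w : List Tile) : EdgeName → Prop
  | base => ∃ l, w[0]? = some l ∧ l.src = false
  | block k e => Uses w k e

theorem wordEdges_valid {w : List Tile} {ε : EdgeName} (h : wordEdges w ε) :
    ε.Valid w.length := by
  rcases ε with _ | ⟨k, e⟩
  · obtain ⟨l, h, -⟩ := h
    exact (List.getElem?_eq_some_iff.1 h).1
  · obtain ⟨l, h, -⟩ := h
    exact (List.getElem?_eq_some_iff.1 h).1

theorem wordEdges_injective {w y : List Tile} (hlen : w.length = y.length)
    (h : ∀ ε, wordEdges w ε ↔ wordEdges y ε) : w = y := by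
  refine List.ext_getElem hlen fun k hw hy => Tile.slots_injective (Finset.ext fun e => ?_)
  simpa [wordEdges, Uses, hw, hy] using h (block k e)

theorem Accepted.uses_zero {s : Bool} {w : List Tile} (h : Accepted s w) :
    (Uses w 0 .cu ↔ s = true) ∧ (Uses w 0 .cv ↔ s = true) := by
  rcases w with _ | ⟨l, w⟩
  · have : s = false := h
    simp [Uses, this]
  · obtain ⟨rfl, -⟩ := h
    simp only [uses_cons_zero]
    revert l
    decide

theorem Accepted.uses_succ {s : Bool} {w : List Tile} (h : Accepted s w) {k : ℕ} {l : Tile}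
    (hl : w[k]? = some l) :
    (Uses w (k + 1) .cu ↔ l.tgt = true) ∧ (Uses w (k + 1) .cv ↔ l.tgt = true) := by
  induction w generalizing s k with
  | nil => simp at hl
  | cons l' w ih =>
    cases k with
    | zero =>
      obtain rfl : l' = l := by simpa using hl
      simpa using h.2.uses_zero
    | succ k => simpa using ih h.2 (by simpa using hl)

theorem Accepted.covered {s : Bool} {w : List Tile} (h : Accepted s w) :
    Covered w.length (wordEdges w) := by
  constructor
  · intro hn
    rcases w with _ | ⟨l, w⟩
    · simp at hn
    have := h.uses_zero
    obtain ⟨rfl, -⟩ := h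
    simp only [wordEdges, this, One₂]
    simp
  · intro k hk
    have hl : w[k]? = some w[k] := by simp [hk]
    have h' := h.uses_succ hl
    simp only [wordEdges, h'.1, h'.2]
    convert w[k].blockCovered using 2 with e
    simp [Uses, hk]

theorem accepted_map_range {n : ℕ} {y : ℕ → Tile} (h : ∀ k < n, (y k).tgt = (y (k + 1)).src)
    (hn : (y n).src = false) : Accepted (y 0).src ((List.range n).map y) := by
  induction n generalizing y with
  | zero => exact hn
  | succ n ih =>
    rw [List.range_succ_eq_map, List.map_cons, List.map_map]
    refine ⟨rfl, ?_⟩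
    rw [h 0 (by omega)]
    exact ih (y := fun k => y (k + 1)) (fun k hk => h (k + 1) (by omega)) hn

theorem Covered.exists_word {n : ℕ} {F : EdgeName → Prop} (h : Covered n F)
    (hF : ∀ ε, F ε → ε.Valid n) :
    ∃ w : List Tile, w.length = n ∧ (∃ s, Accepted s w) ∧ ∀ ε, F ε ↔ wordEdges w ε := by
  obtain ⟨h0, h⟩ := h
  -- At column 0 both edges are complementary to `u₀v₀`; afterwards the tile of each block passes
  -- the agreement on. From block `n` on, both edges are absent.
  have hpar : ∀ k, F (block k .cu) ↔ F (block k .cv) := by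
    intro k
    induction k with
    | zero =>
      by_cases hn : 1 ≤ n
      · have := h0 hn
        unfold One₂ at this
        grind
      · exact iff_of_false (fun h => hn (Nat.pos_of_ne_zero fun h' => by
          have := hF _ h; simp [Valid] at this; omega))
          (fun h => by have := hF _ h; simp [Valid] at this; omega)
    | succ k ih =>
      by_cases hk : k < n
      · obtain ⟨l, -, h1, h2⟩ := (h k hk).exists_tile ih
        exact h1.trans h2.symm
      · exact iff_of_false (fun h => by have := hF _ h; simp [Valid] at this; omega)
          (fun h => by have := hF _ h; simp [Valid] at this; omega)
  have hex : ∀ k, ∃ l : Tile, (F (block k .cu) ↔ l.src = true) ∧ (k < n →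
      (∀ e, F (block k e) ↔ e ∈ l.slots) ∧ (F (block (k + 1) .cu) ↔ l.tgt = true)) := by
    intro k
    by_cases hk : k < n
    · obtain ⟨l, h1, h2, -⟩ := (h k hk).exists_tile (hpar k)
      have hsrc : ∀ l : Tile, .cu ∈ l.slots ↔ l.src = true := by decide
      exact ⟨l, (h1 .cu).trans (hsrc l), fun _ => ⟨h1, h2⟩⟩
    -- Beyond the last block any tile with `src = false` serves as a default, matching the absent
    -- edges.
    · exact ⟨.rungs, iff_of_false (fun h => by have := hF _ h; simp [Valid] at this; omega)
        (by decide), fun h => absurd h hk⟩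
  choose y hy hy' using hex
  have hu : ∀ k e, Uses ((List.range n).map y) k e ↔ k < n ∧ e ∈ (y k).slots := by
    intro k e
    by_cases hk : k < n <;> simp [Uses, hk]
  refine ⟨(List.range n).map y, by simp, ⟨_, accepted_map_range (fun k hk => ?_) ?_⟩, ?_⟩
  · rw [Bool.eq_iff_iff, ← (hy' k hk).2, hy]
  -- Block `n` does not exist, so nothing leaves the last block.
  · rw [← Bool.not_eq_true, ← hy]
    exact fun h => by have := hF _ h; simp [Valid] at this
  · rintro (_ | ⟨k, e⟩)
    · by_cases hn : 1 ≤ n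
      · have h1 : F base ↔ ¬ F (block 0 .cu) := by
          have := (h0 hn).1
          unfold One₂ at this
          tauto
        rw [h1, hy]
        simp [wordEdges, List.getElem?_range (show 0 < n from hn)]
      · obtain rfl : n = 0 := by omega
        exact iff_of_false (fun h => hn (hF _ h)) (by simp [wordEdges])
    · rw [wordEdges, hu]
      exact ⟨fun h => ⟨hF _ h, ((hy' k (hF _ h)).1 e).1 h⟩,
        fun h => ((hy' k h.1).1 e).2 h.2⟩

/-- The perfect matchings of a subgraph of `G n` are described by words of tiles. -/
theorem isPerfectMatching_iff {n : ℕ} {H : SimpleGraph (Vertex n)} (hH : H ≤ G n)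
    (N : H.Subgraph) :
    N.IsPerfectMatching ↔ ∃ w : List Tile, w.length = n ∧ (∃ s, Accepted s w) ∧
      ∀ a b, N.Adj a b ↔ Rel (wordEdges w) a.1 b.1 := by
  rw [SimpleGraph.Subgraph.isPerfectMatching_iff]
  have hocc : ∀ {F : EdgeName → Prop}, (∀ ε, F ε → ε.Valid n) → ∀ {a b : Label}, Rel F a b →
      b.Occurs n := by
    rintro F hF a b ⟨ε, h, he⟩
    have := (hF ε h).occurs
    rcases Sym2.eq_iff.1 he with ⟨-, h2⟩ | ⟨h1, -⟩
    · exact h2 ▸ this.2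
    · exact h1 ▸ this.1
  constructor
  · intro h
    let F : EdgeName → Prop := fun ε => ε.Valid n ∧ ∃ a b, N.Adj a b ∧ ε.toSym2 = s(a.1, b.1)
    have hF : ∀ ε, F ε → ε.Valid n := fun ε h => h.1
    have hadj : ∀ a b : Vertex n, N.Adj a b ↔ Rel F a.1 b.1 := by
      intro a b
      constructor
      · intro hab
        obtain ⟨ε, hε, he⟩ := G_adj_iff.1 (hH (N.adj_sub hab))
        exact ⟨ε, ⟨hε, a, b, hab, he⟩, he⟩
      · rintro ⟨ε, ⟨hε, c, d, hcd, he⟩, he'⟩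
        rw [he] at he'
        rcases Sym2.eq_iff.1 he' with ⟨h1, h2⟩ | ⟨h1, h2⟩
        · rwa [← Subtype.ext h1, ← Subtype.ext h2]
        · rw [← Subtype.ext h1, ← Subtype.ext h2]
          exact hcd.symm
    have hcov : Covered n F := by
      rw [covered_iff]
      intro a ha
      obtain ⟨b, hb, hu⟩ := h ⟨a, ha⟩
      exact ⟨b.1, (hadj _ _).1 hb, fun c hc =>
        congrArg Subtype.val (hu ⟨c, hocc hF hc⟩ ((hadj _ _).2 hc))⟩
    obtain ⟨w, hw, hs, hFw⟩ := hcov.exists_word hF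
    refine ⟨w, hw, hs, fun a b => (hadj a b).trans ?_⟩
    rw [show F = wordEdges w from funext fun ε => propext (hFw ε)]
  · rintro ⟨w, rfl, ⟨s, hs⟩, hadj⟩ a
    obtain ⟨b, hb, hu⟩ := covered_iff.1 hs.covered a.1 a.2
    exact ⟨⟨b, hocc (fun _ => wordEdges_valid) hb⟩, (hadj _ _).2 hb,
      fun c hc => Subtype.ext (hu _ ((hadj _ _).1 hc))⟩

theorem Accepted.start_unique {s s' : Bool} {w : List Tile} (h : Accepted s w)
    (h' : Accepted s' w) : s = s' := by
  cases w with
  | nil => exact Eq.trans h (Eq.symm h')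
  | cons l w => exact h.1.symm.trans h'.1

theorem Accepted.wordEdges_base {s : Bool} {w : List Tile} (h : Accepted s w) :
    wordEdges w base ↔ 1 ≤ w.length ∧ s = false := by
  cases w with
  | nil => simp [wordEdges]
  | cons l w => simp [wordEdges, h.1]

/-- Words of tiles that describe the same relation on the vertices of `G n` are equal. -/
theorem word_ext {w y : List Tile} (hlen : y.length = w.length)
    (h : ∀ a b : Vertex w.length, Rel (wordEdges y) a.1 b.1 ↔ Rel (wordEdges w) a.1 b.1) :
    y = w := by
  refine wordEdges_injective hlen fun ε => ?_
  by_cases hε : ε.Valid w.length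
  · have := h ⟨_, hε.occurs.1⟩ ⟨_, hε.occurs.2⟩
    rwa [rel_fst_snd, rel_fst_snd] at this
  · exact iff_of_false (fun h => hε (hlen ▸ wordEdges_valid h)) fun h => hε (wordEdges_valid h)

/-! ### Anti-forcing sets as hitting sets of words -/

/-- The edge with name `ε` belongs to `S`. -/
def Named {n : ℕ} (S : Finset (Sym2 (Vertex n))) (ε : EdgeName) : Prop :=
  ∃ x ∈ S, x.map Subtype.val = ε.toSym2

theorem named_iff {n : ℕ} {S : Finset (Sym2 (Vertex n))} {ε : EdgeName} {a b : Vertex n}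
    (h : ε.toSym2 = s(a.1, b.1)) : Named S ε ↔ s(a, b) ∈ S := by
  constructor
  · rintro ⟨x, hx, he⟩
    have : x = s(a, b) := Sym2.map.injective Subtype.val_injective (he.trans h)
    exact this ▸ hx
  · exact fun hx => ⟨_, hx, h.symm⟩

open Classical in
theorem card_le_card_of_named {n : ℕ} {S : Finset (Sym2 (Vertex n))} {T : Finset EdgeName}
    (h : ∀ ε ∈ T, Named S ε) : T.card ≤ S.card := by
  rw [← Finset.card_image_of_injective T toSym2_injective]
  refine (Finset.card_le_card ?_).trans (Finset.card_image_le (s := S) (f := Sym2.map Subtype.val))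
  intro x hx
  obtain ⟨ε, hε, rfl⟩ := Finset.mem_image.1 hx
  obtain ⟨y, hy, he⟩ := h ε hε
  exact Finset.mem_image.2 ⟨y, hy, he⟩

open Classical in
theorem card_le_card_of_names {n : ℕ} {S : Finset (Sym2 (Vertex n))} {T : Finset EdgeName}
    (h : ∀ x ∈ S, ∃ ε ∈ T, x.map Subtype.val = ε.toSym2) : S.card ≤ T.card := by
  rw [← Finset.card_image_of_injective S (Sym2.map.injective Subtype.val_injective)]
  refine (Finset.card_le_card ?_).trans (Finset.card_image_le (s := T) (f := toSym2))
  intro x hx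
  obtain ⟨y, hy, rfl⟩ := Finset.mem_image.1 hx
  obtain ⟨ε, hε, he⟩ := h y hy
  exact Finset.mem_image.2 ⟨ε, hε, he.symm⟩

/-- The spanning subgraph described by a word of tiles. -/
def ofWord {n : ℕ} (H : SimpleGraph (Vertex n)) (w : List Tile) : H.Subgraph where
  verts := Set.univ
  Adj a b := H.Adj a b ∧ Rel (wordEdges w) a.1 b.1
  adj_sub h := h.1
  edge_vert _ := Set.mem_univ _
  symm := ⟨fun _ _ ⟨h, ε, hε, he⟩ => ⟨h.symm, ε, hε, he.trans Sym2.eq_swap⟩⟩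

/-- The perfect matchings of `G - S` are exactly the accepted words none of whose edges lies in `S`,
so uniqueness becomes a statement about words alone. -/
theorem isAntiForcingSet_iff {n : ℕ} {M : (G n).Subgraph} {w : List Tile} (hw : w.length = n)
    {s : Bool} (hs : Accepted s w) (hM : ∀ a b, M.Adj a b ↔ Rel (wordEdges w) a.1 b.1)
    (S : Finset (Sym2 (Vertex n))) :
    (G n).IsAntiForcingSet M S ↔ (S : Set (Sym2 (Vertex n))) ⊆ (G n).edgeSet ∧
      (∀ ε, wordEdges w ε → ¬ Named S ε) ∧
      ∀ (y : List Tile) (t : Bool), y.length = n → Accepted t y →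
        (∀ ε, wordEdges y ε → ¬ Named S ε) → y = w := by
  subst hw
  have hle : (G w.length).deleteEdges (S : Set (Sym2 (Vertex w.length))) ≤ G w.length :=
    SimpleGraph.deleteEdges_le _
  constructor
  · rintro ⟨hS, hN⟩
    refine ⟨fun x hx => (hS hx).1, ?_, ?_⟩
    · rintro ε hε ⟨x, hx, he⟩
      induction x using Sym2.ind with
      | _ a b =>
        exact (hS hx).2 ((hM a b).2 ⟨ε, hε, he.symm⟩)
    · intro y t hy ht hav
      have hadj : ∀ a b, (ofWord ((G w.length).deleteEdges (S : Set (Sym2 (Vertex w.length)))) y).Adj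
          a b ↔ Rel (wordEdges y) a.1 b.1 := by
        refine fun a b => ⟨fun h => h.2, fun h => ⟨?_, h⟩⟩
        obtain ⟨ε, hε, he⟩ := h
        rw [SimpleGraph.deleteEdges_adj]
        exact ⟨G_adj_iff.2 ⟨ε, hy ▸ wordEdges_valid hε, he⟩,
          fun hx => hav ε hε ((named_iff he).2 hx)⟩
      have hE := (hN _).1 ((isPerfectMatching_iff hle _).2 ⟨y, hy, ⟨t, ht⟩, hadj⟩)
      refine word_ext hy fun a b => ?_
      rw [← hadj, ← hM, ← SimpleGraph.Subgraph.mem_edgeSet, hE, SimpleGraph.Subgraph.mem_edgeSet]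
  · rintro ⟨hS, hSw, hy⟩
    refine ⟨fun x hx => ⟨hS hx, fun hxM => ?_⟩, fun N => ⟨fun hN => ?_, fun hN => ?_⟩⟩
    · induction x using Sym2.ind with
      | _ a b =>
        obtain ⟨ε, hε, he⟩ := (hM a b).1 hxM
        exact hSw ε hε ((named_iff he).2 hx)
    · obtain ⟨y, hlen, ⟨t, ht⟩, hadj⟩ := (isPerfectMatching_iff hle N).1 hN
      obtain rfl : y = w := by
        refine hy y t hlen ht fun ε hε => ?_
        have hv := (wordEdges_valid hε).occurs
        rw [hlen] at hv
        rw [named_iff (a := ⟨_, hv.1⟩) (b := ⟨_, hv.2⟩) rfl]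
        have := N.adj_sub ((hadj ⟨_, hv.1⟩ ⟨_, hv.2⟩).2 (rel_fst_snd.2 hε))
        rw [SimpleGraph.deleteEdges_adj] at this
        exact this.2
      ext x
      induction x using Sym2.ind with
      | _ a b => exact (hadj a b).trans (hM a b).symm
    · refine (isPerfectMatching_iff hle N).2 ⟨w, rfl, ⟨s, hs⟩, fun a b => ?_⟩
      rw [← hM, ← SimpleGraph.Subgraph.mem_edgeSet, hN, SimpleGraph.Subgraph.mem_edgeSet]

/-- The mode in which the reading of a word starts. -/
def Mode.start : Bool → Mode
  | false => freeOpen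
  | true => linkClosed

@[simp] theorem Mode.linked_start (s : Bool) : (start s).linked = s := by
  cases s <;> rfl

/-- The size of the anti-forcing set for a word that starts with `s`, including `u₀v₀`. -/
def totalCost (s : Bool) (w : List Tile) : ℕ :=
  (Mode.start s).cost w + s.toNat

theorem exists_isAntiForcingSet {n : ℕ} {M : (G n).Subgraph} {w : List Tile} (hw : w.length = n)
    {s : Bool} (hs : Accepted s w) (hM : ∀ a b, M.Adj a b ↔ Rel (wordEdges w) a.1 b.1) :
    ∃ S : Finset (Sym2 (Vertex n)), (G n).IsAntiForcingSet M S ∧ S.card ≤ totalCost s w := by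
  let q := Mode.start s
  let B : Finset EdgeName := (Finset.range n).biUnion fun k => (q.cuts w k).image (block k)
  -- If the matching crosses from column 0, then `u₀v₀` is outside it; deleting this edge destroys
  -- every word with the free start and justifies starting in `linkClosed`. Otherwise `u₀v₀` belongs
  -- to the matching and must stay.
  let T : Finset EdgeName := B ∪ if s then {base} else ∅
  have hTbase : base ∈ T ↔ s = true := by
    cases s <;> simp [T, B]
  have hTblock : ∀ k e, block k e ∈ T ↔ k < n ∧ e ∈ q.cuts w k := by
    intro k e
    cases s <;> simp [T, B]
  let S : Finset (Sym2 (Vertex n)) :=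
    (Set.toFinite {x | ∃ ε ∈ T, ε.Valid n ∧ x.map Subtype.val = ε.toSym2}).toFinset
  have hmem : ∀ x, x ∈ S ↔ ∃ ε ∈ T, ε.Valid n ∧ x.map Subtype.val = ε.toSym2 := by simp [S]
  have hnamed : ∀ ε, Named S ε ↔ ε ∈ T ∧ ε.Valid n := by
    intro ε
    constructor
    · rintro ⟨x, hx, he⟩
      obtain ⟨ε', h1, h2, h3⟩ := (hmem x).1 hx
      rw [toSym2_injective (he.symm.trans h3)]
      exact ⟨h1, h2⟩
    · rintro ⟨h1, h2⟩
      rw [named_iff (a := ⟨_, h2.occurs.1⟩) (b := ⟨_, h2.occurs.2⟩) rfl, hmem]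
      exact ⟨ε, h1, h2, rfl⟩
  refine ⟨S, (isAntiForcingSet_iff hw hs hM S).2 ⟨fun x hx => ?_, ?_, ?_⟩, ?_⟩
  · obtain ⟨ε, -, h2, h3⟩ := (hmem x).1 hx
    induction x using Sym2.ind with
    | _ a b => exact G_adj_iff.2 ⟨ε, h2, h3.symm⟩
  · rintro (_ | ⟨k, e⟩) hε <;> rw [hnamed]
    · rw [hTbase, (hs.wordEdges_base.1 hε).2]
      simp
    · rw [hTblock]
      exact fun h => Mode.not_mem_cuts_of_uses (q := q) (by simpa [q] using hs) hε h.1.2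
  · intro y t hy ht hav
    have hlen := hy.trans hw.symm
    refine Mode.eq_of_avoids_cuts (q := q) (by simpa [q] using hs) ht hlen ?_ fun k e hk he => ?_
    · cases hst : s with
      | false => right; simp [q, hst, Mode.start, Mode.isOpen]
      | true =>
        left
        rw [Mode.linked_start, hst, ← Bool.not_eq_false]
        intro hf
        have hpos : 1 ≤ n := by
          rw [← hw]
          rcases w with _ | ⟨l, w⟩
          · rw [hst] at hs
            exact absurd hs (by simp [Accepted])
          · simp
        exact hav base (ht.wordEdges_base.2 ⟨hy ▸ hpos, hf⟩)
          ((hnamed _).2 ⟨hTbase.2 hst, hpos⟩)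
    · have hv : k < n := hy ▸ wordEdges_valid (ε := block k e) hk
      exact hav (block k e) hk ((hnamed _).2 ⟨(hTblock k e).2 ⟨hv, he⟩, hv⟩)
  · refine (card_le_card_of_names (T := T) fun x hx => ?_).trans ?_
    · obtain ⟨ε, h1, -, h3⟩ := (hmem x).1 hx
      exact ⟨ε, h1, h3⟩
    · refine (Finset.card_union_le _ _).trans (add_le_add ?_ ?_)
      · rw [← Mode.sum_card_cuts, hw]
        exact Finset.card_biUnion_le.trans (Finset.sum_le_sum fun k _ => Finset.card_image_le)
      · cases s <;> simp

open Classical in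
theorem totalCost_le_card {n : ℕ} {M : (G n).Subgraph} {w : List Tile} (hw : w.length = n)
    {s : Bool} (hs : Accepted s w) (hM : ∀ a b, M.Adj a b ↔ Rel (wordEdges w) a.1 b.1)
    {S : Finset (Sym2 (Vertex n))} (hS : (G n).IsAntiForcingSet M S) :
    totalCost s w ≤ S.card := by
  obtain ⟨-, hSw, hSy⟩ := (isAntiForcingSet_iff hw hs hM S).1 hS
  let q := Mode.start s
  let B : Finset EdgeName := ((Finset.range n ×ˢ (Finset.univ : Finset Slot)).filter
    fun p => Named S (block p.1 p.2)).image fun p => block p.1 p.2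
  have hB : ∀ ε ∈ B, Named S ε := by
    intro ε hε
    obtain ⟨p, hp, rfl⟩ := Finset.mem_image.1 hε
    exact (Finset.mem_filter.1 hp).2
  let x : ℕ → Slot → ℕ := fun k e => if Named S (block k e) then 1 else 0
  have hBcard : B.card = ∑ k ∈ Finset.range n, ∑ e, x k e := by
    rw [Finset.card_image_of_injective _ (fun p p' h => by
      rw [block.injEq] at h; exact Prod.ext h.1 h.2), Finset.card_filter, Finset.sum_product]
  -- Competitors with the other start may be counted as alive (`o = true`) unless `S` has destroyed
  -- them through `u₀v₀`.
  have key : ∀ o : Bool, (o = true → s = true → ¬ Named S base) →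
      (q.cost w : ℤ) + q.surcharge o ≤ B.card := by
    intro o ho
    rw [hBcard, ← hw]
    push_cast
    refine Mode.cost_add_surcharge_le o (by simpa [q] using hs) (fun k e hk => ?_) ?_
    · simpa [x] using hSw (block k e) hk
    · intro t y ht hlen hto hne
      by_contra! hcon
      have hyw : y = w := by
        refine hSy y t (hlen.trans hw) ht ?_
        rintro (_ | ⟨k, e⟩) hε
        · obtain ⟨hpos, rfl⟩ := ht.wordEdges_base.1 hε
          cases hst : s with
          | false => exact hSw base (hs.wordEdges_base.2 ⟨hlen ▸ hpos, hst⟩)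
          | true => exact ho (hto.resolve_left (by simp [q, hst])) hst
        · simpa [x] using hcon k e hε
      subst hyw
      exact hne.elim (fun h => h (by simpa [q] using ht.start_unique hs)) fun h => h rfl
  have hle := card_le_card_of_named hB
  cases hst : s with
  | false =>
    have := key true (by simp [hst])
    simp only [q, hst, Mode.start, Mode.surcharge] at this
    simp only [totalCost, Mode.start, Bool.toNat_false]
    omega
  | true =>
    simp only [totalCost, Mode.start, Bool.toNat_true]
    -- Either `S` pays 1 for `u₀v₀`, or the surcharge of `linkClosed` makes it pay at least 1 inside
    -- the blocks.
    by_cases hb : Named S base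
    · have := key false (by simp)
      simp only [q, hst, Mode.start, Mode.surcharge] at this
      have hle' : (insert base B).card ≤ S.card :=
        card_le_card_of_named fun ε hε => (Finset.mem_insert.1 hε).elim (fun h => h ▸ hb) (hB ε)
      rw [Finset.card_insert_of_notMem (by simp [B])] at hle'
      omega
    · have := key true fun _ _ => hb
      simp only [q, hst, Mode.start, Mode.surcharge] at this
      omega

theorem antiForcingNumber_eq {n : ℕ} {M : (G n).Subgraph} {w : List Tile} (hw : w.length = n)
    {s : Bool} (hs : Accepted s w) (hM : ∀ a b, M.Adj a b ↔ Rel (wordEdges w) a.1 b.1) :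
    (G n).antiForcingNumber M = totalCost s w := by
  obtain ⟨S, hS, hcard⟩ := exists_isAntiForcingSet hw hs hM
  have hmem : S.card ∈ {k : ℕ | ∃ S : Finset (Sym2 (Vertex n)),
      (G n).IsAntiForcingSet M S ∧ S.card = k} := ⟨S, hS, rfl⟩
  obtain ⟨S', hS', hcard'⟩ := Nat.sInf_mem ⟨_, hmem⟩
  exact le_antisymm ((Nat.sInf_le hmem).trans hcard)
    ((totalCost_le_card hw hs hM hS').trans hcard'.le)

/-! ### Summing the costs -/

/-- The accepted words of given length and start. -/
def words : ℕ → Bool → Finset (List Tile)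
  | 0, s => if s then ∅ else {[]}
  | n + 1, s => (Finset.univ.filter fun l : Tile => l.src = s).biUnion fun l =>
      (words n l.tgt).image (List.cons l)

theorem mem_words {n : ℕ} {s : Bool} {w : List Tile} :
    w ∈ words n s ↔ w.length = n ∧ Accepted s w := by
  induction n generalizing s w with
  | zero =>
    cases s
    · simp only [words, Bool.false_eq_true, if_false, Finset.mem_singleton, List.length_eq_zero_iff]
      exact ⟨fun h => ⟨h, h ▸ rfl⟩, fun h => h.1⟩
    · simp only [words, if_true, Finset.notMem_empty, List.length_eq_zero_iff, false_iff]
      rintro ⟨rfl, h⟩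
      simp [Accepted] at h
  | succ n ih =>
    rcases w with _ | ⟨l, w⟩
    · simp [words]
    · simp [words, ih, Accepted]
      tauto

theorem sum_words_succ {R : Type*} [AddCommMonoid R] (n : ℕ) (s : Bool) (f : List Tile → R) :
    ∑ w ∈ words (n + 1) s, f w =
      ∑ l ∈ Finset.univ.filter fun l : Tile => l.src = s, ∑ w ∈ words n l.tgt, f (l :: w) := by
  rw [words, Finset.sum_biUnion]
  · exact Finset.sum_congr rfl fun l _ => Finset.sum_image (by simp)
  · intro l _ l' _ hne
    rw [Function.onFun, Finset.disjoint_left]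
    simp only [Finset.mem_image, not_exists, not_and]
    rintro _ ⟨w, -, rfl⟩ w' - h
    exact hne (List.cons.inj h).1.symm

theorem mem_perfectMatchings {n : ℕ} {M : (G n).Subgraph} :
    M ∈ (G n).perfectMatchings ↔ M.IsPerfectMatching := by
  simp [SimpleGraph.perfectMatchings]

/-- The start is determined by the word, so summing over both starts counts every perfect matching
once. -/
theorem sum_antiForcingNumber (n : ℕ) :
    ∑ M ∈ (G n).perfectMatchings, (G n).antiForcingNumber M =
      ∑ s : Bool, ∑ w ∈ words n s, totalCost s w := by
  have hadj : ∀ w : List Tile, w.length = n → ∀ a b, (ofWord (G n) w).Adj a b ↔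
      Rel (wordEdges w) a.1 b.1 := by
    rintro w rfl a b
    exact ⟨fun h => h.2, fun ⟨ε, hε, he⟩ => ⟨G_adj_iff.2 ⟨ε, wordEdges_valid hε, he⟩, ε, hε, he⟩⟩
  rw [Finset.sum_sigma' Finset.univ (words n) totalCost]
  symm
  refine Finset.sum_bij (fun p _ => ofWord (G n) p.2) ?_ ?_ ?_ ?_
  · rintro ⟨s, w⟩ h
    obtain ⟨hw, hs⟩ := mem_words.1 (Finset.mem_sigma.1 h).2
    exact mem_perfectMatchings.2 ((isPerfectMatching_iff le_rfl _).2 ⟨w, hw, ⟨s, hs⟩, hadj w hw⟩)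
  · rintro ⟨s, w⟩ h ⟨t, y⟩ h' he
    obtain ⟨hw, hs⟩ := mem_words.1 (Finset.mem_sigma.1 h).2
    obtain ⟨hy, ht⟩ := mem_words.1 (Finset.mem_sigma.1 h').2
    dsimp only at he hw hs hy ht
    obtain rfl : w = y := by
      subst hy
      refine word_ext hw fun a b => ?_
      rw [← hadj w hw, ← hadj y rfl, he]
    rw [hs.start_unique ht]
  · intro M hM
    rw [mem_perfectMatchings] at hM
    obtain ⟨w, hw, ⟨s, hs⟩, h⟩ := (isPerfectMatching_iff le_rfl M).1 hM
    refine ⟨⟨s, w⟩, by simpa using mem_words.2 ⟨hw, hs⟩, SimpleGraph.Subgraph.ext ?_ ?_⟩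
    · exact (Set.eq_univ_of_forall hM.2).symm
    · ext a b
      rw [hadj w hw, h]
  · rintro ⟨s, w⟩ h
    obtain ⟨hw, hs⟩ := mem_words.1 (Finset.mem_sigma.1 h).2
    exact (antiForcingNumber_eq hw hs (hadj w hw)).symm

theorem sum_tiles_src {R : Type*} [AddCommMonoid R] (s : Bool) (f : Tile → R) :
    ∑ l ∈ Finset.univ.filter (fun l : Tile => l.src = s), f l =
      if s then f .closing + f .through
      else f .rungs + (f .bars + (f .wLegs + (f .zLegs + (f .legs + f .opening)))) := by
  have hf : Finset.univ.filter (fun l : Tile => l.src = false) =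
    {.rungs, .bars, .wLegs, .zLegs, .legs, .opening} := by decide
  have ht : Finset.univ.filter (fun l : Tile => l.src = true) = {.closing, .through} := by decide
  cases s
  · rw [hf]; simp
  · rw [ht]; simp

/-- The sum of the costs of all words that may be read starting in a given mode. -/
noncomputable def costSum (n : ℕ) (q : Mode) : ℝ :=
  ∑ w ∈ words n q.linked, (q.cost w : ℝ)

theorem card_words_succ (n : ℕ) :
    ((words (n + 1) false).card : ℝ) = 5 * (words n false).card + (words n true).card ∧
      ((words (n + 1) true).card : ℝ) = (words n false).card + (words n true).card := by
  constructor <;> simp only [Finset.card_eq_sum_ones, sum_words_succ, sum_tiles_src, Tile.tgt] <;>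
    simp
  ring

theorem costSum_succ (n : ℕ) (q : Mode) :
    costSum (n + 1) q = ∑ l ∈ Finset.univ.filter (fun l : Tile => l.src = q.linked),
      ((words n l.tgt).card * ((q.cut l).card : ℝ) + costSum n (q.next l)) := by
  rw [costSum, sum_words_succ]
  refine Finset.sum_congr rfl fun l hl => ?_
  rw [costSum, Mode.linked_next q l (Finset.mem_filter.1 hl).2]
  simp [Mode.cost, Finset.sum_add_distrib]

/-- The coefficients of the word counts are the cut sizes added over tiles with the same exit: for
`freeOpen`, 3 + 3 + 2 + 2 + 2 = 12 and 1 for `opening`. -/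
theorem costSum_recurrence (n : ℕ) :
    costSum (n + 1) .freeOpen = 12 * (words n false).card + (words n true).card
        + 2 * costSum n .freeOpen + 3 * costSum n .freeClosed + costSum n .linkOpen ∧
      costSum (n + 1) .freeClosed = 11 * (words n false).card
        + costSum n .freeOpen + 4 * costSum n .freeClosed + costSum n .linkOpen ∧
      costSum (n + 1) .linkClosed = (words n true).card
        + costSum n .linkClosed + costSum n .freeOpen ∧
      costSum (n + 1) .linkOpen = 3 * (words n false).card + (words n true).card
        + costSum n .linkOpen + costSum n .freeOpen := by
  refine ⟨?_, ?_, ?_, ?_⟩ <;> rw [costSum_succ, sum_tiles_src] <;>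
    simp [Mode.linked, Mode.cut, Mode.next, Tile.tgt] <;> ring

theorem closed_forms (n : ℕ) :
    ((words n false).card : ℝ) =
        (1 / 2 + √5 / 5) * (3 + √5) ^ n + (1 / 2 - √5 / 5) * (3 - √5) ^ n ∧
      ((words n true).card : ℝ) = √5 / 10 * (3 + √5) ^ n - √5 / 10 * (3 - √5) ^ n ∧
      costSum n .freeOpen =
        (3 * √5 / 25 + (79 + 39 * √5) / 80 * n) * (3 + √5) ^ n
          + (-(3 * √5 / 25) + (79 - 39 * √5) / 80 * n) * (3 - √5) ^ n ∧
      costSum n .freeClosed =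
        (-1 / 2 + 11 * √5 / 50 + (79 + 39 * √5) / 80 * n) * (3 + √5) ^ n
          + (-1 / 2 - 11 * √5 / 50 + (79 - 39 * √5) / 80 * n) * (3 - √5) ^ n + 1 ∧
      costSum n .linkClosed =
        (3 / 2 - 89 * √5 / 100 + (37 + √5) / 80 * n) * (3 + √5) ^ n
          + (3 / 2 + 89 * √5 / 100 + (37 - √5) / 80 * n) * (3 - √5) ^ n - 3 ∧
      costSum n .linkOpen =
        (3 / 2 - 59 * √5 / 100 + (37 + √5) / 80 * n) * (3 + √5) ^ n
          + (3 / 2 + 59 * √5 / 100 + (37 - √5) / 80 * n) * (3 - √5) ^ n - 3 := by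
  induction n with
  | zero => simp [words, costSum, Mode.cost, Mode.linked]; norm_num
  | succ n ih =>
    obtain ⟨h1, h2, h3, h4, h5, h6⟩ := ih
    obtain ⟨c1, c2⟩ := card_words_succ n
    obtain ⟨d1, d2, d3, d4⟩ := costSum_recurrence n
    have hs : √5 * √5 = (5 : ℝ) := Real.mul_self_sqrt (by norm_num)
    rw [c1, c2, d1, d2, d3, d4, h1, h2, h3, h4, h5, h6]
    push_cast
    refine ⟨?_, ?_, ?_, ?_, ?_, ?_⟩
    -- In each case the factor is the coefficient of `√5` in the closed form at `n + 1`: multiplying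
    -- by `3 ± √5` turns exactly that part into a multiple of `√5 * √5`.
    · linear_combination -(1 / 5) * ((3 + √5) ^ n + (3 - √5) ^ n) * hs
    · linear_combination -(1 / 10) * ((3 + √5) ^ n + (3 - √5) ^ n) * hs
    · linear_combination -(3 / 25 + 39 / 80 * (n + 1)) * ((3 + √5) ^ n + (3 - √5) ^ n) * hs
    · linear_combination -(11 / 50 + 39 / 80 * (n + 1)) * ((3 + √5) ^ n + (3 - √5) ^ n) * hs
    · linear_combination -(-89 / 100 + 1 / 80 * (n + 1)) * ((3 + √5) ^ n + (3 - √5) ^ n) * hs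
    · linear_combination -(-59 / 100 + 1 / 80 * (n + 1)) * ((3 + √5) ^ n + (3 - √5) ^ n) * hs

/-- The last summand accounts for `u₀v₀`, cut once for every word with start `true`. -/
theorem sum_totalCost (n : ℕ) :
    ((∑ s : Bool, ∑ w ∈ words n s, totalCost s w : ℕ) : ℝ) =
      costSum n .freeOpen + costSum n .linkClosed + (words n true).card := by
  simp [totalCost, Finset.sum_add_distrib, Mode.start, costSum, Mode.linked]
  ring

end Polyomino

theorem theorem4p4 (n : ℕ) :
    (∑ M ∈ (Polyomino.G n).perfectMatchings, ((Polyomino.G n).antiForcingNumber M : ℝ)) =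
        -3 + (150 + 67 * √5) / 100 * (3 - √5) ^ n
          + (29 - 10 * √5) / 20 * n * (3 - √5) ^ n
          + (150 - 67 * √5) / 100 * (3 + √5) ^ n
          + (29 + 10 * √5) / 20 * n * (3 + √5) ^ n ∧
      (Polyomino.G n).antiForcingPolynomial.derivative.eval 1 =
        -3 + (150 + 67 * √5) / 100 * (3 - √5) ^ n
          + (29 - 10 * √5) / 20 * n * (3 - √5) ^ n
          + (150 - 67 * √5) / 100 * (3 + √5) ^ n
          + (29 + 10 * √5) / 20 * n * (3 + √5) ^ n := by
  have hderiv : (Polyomino.G n).antiForcingPolynomial.derivative.eval 1 =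
      ∑ M ∈ (Polyomino.G n).perfectMatchings, ((Polyomino.G n).antiForcingNumber M : ℝ) := by
    simp [SimpleGraph.antiForcingPolynomial, Polynomial.eval_finsetSum, Polynomial.derivative_X_pow]
  rw [hderiv, and_self, ← Nat.cast_sum, Polyomino.sum_antiForcingNumber, Polyomino.sum_totalCost]
  obtain ⟨-, h2, h3, -, h5, -⟩ := Polyomino.closed_forms n
  rw [h2, h3, h5]
  ring
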